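/- Let $\mathcal A$ and $\mathcal X$ be finite alphabets with $\mathcal X\neq\emptyset$, and let $B$ be a quantum system with finite-dimensional Hilbert space. An assemblage $\hat\rho=\{\hat\rho^{a,x}\}_{a\in\mathcal A,x\in\mathcal X}$ is a family of positive semidefinite operators on $B$ such that $\sum_a\hat\rho^{a,x}$ is a density operator that does not depend on $x$. Let $\mathrm{LHS}$ be the set of assemblages with a local-hidden-state model, that is, of the form $\hat\sigma^{a,x}=\sum_\lambda p(\lambda)\,p(a|x,\lambda)\,\sigma^\lambda$, where $\lambda$ ranges over a finite set, $p(\lambda)$ is a probability distribution, $p(a|x,\lambda)$ is a conditional probability distribution, and every $\sigma^\lambda$ is a density operator. Let $D(\rho\Vert\sigma)=\operatorname{Tr}(\rho[\log_2\rho-\log_2\sigma])$ if the support of $\rho$ is contained in the support of $\sigma$, and $D(\rho\Vert\sigma)=+\infty$ otherwise, where operator logarithms are taken on the support. The restricted relative entropy of steering of $\hat\rho$ is $$R_S^R(\hat\rho)=\sup_{p_X}\ \inf_{\hat\sigma\in\mathrm{LHS}} D\Big(\sum_{x,a}p_X(x)|x\rangle\langle x|\otimes|a\rangle\langle a|\otimes\hat\rho^{a,x}\,\Big\Vert\,\sum_{x,a}p_X(x)|x\rangle\langle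 x|\otimes|a\rangle\langle a|\otimes\hat\sigma^{a,x}\Big),$$ the supremum being over probability distributions $p_X$ on $\mathcal X$. Proposition. Let $\hat\rho$ be an assemblage. Then $R_S^R(\hat\rho)$ is a finite non-negative real number and $$\sqrt{2\ln 2\;R_S^R(\hat\rho)}\ \ge\ \inf_{\hat\sigma\in\mathrm{LHS}}\frac1{|\mathcal X|}\sum_{x,a}\big\Vert\hat\rho^{a,x}-\hat\sigma^{a,x}\big\Vert_1 ,$$ where $\Vert M\Vert_1=\operatorname{Tr}\sqrt{M^\dagger M}$. In particular, if $R_S^R(\hat\rho)=0$, then $\hat\rho\in\mathrm{LHS}$. -/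

import Mathlib

open scoped Kronecker ComplexOrder

namespace Steering

noncomputable section

/-- Density operators (quantum states) on the finite-dimensional Hilbert space `ℂ^n`. -/
def IsState {n : Type*} [Fintype n] (ρ : Matrix n n ℂ) : Prop :=
  ρ.PosSemidef ∧ ρ.trace = 1

/-- The trace norm `‖M‖₁ = Tr √(M† M)`. -/
def traceNorm {n : Type*} [Fintype n] [DecidableEq n] (M : Matrix n n ℂ) : ℝ :=
  (cfc Real.sqrt (M.conjTranspose * M)).trace.re

open scoped Classical in
/-- The quantum relative entropy `D(ρ‖σ) = Tr (ρ [log₂ ρ - log₂ σ])` if `supp ρ ⊆ supp σ`, and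
`+∞` otherwise. For positive semidefinite operators `supp ρ ⊆ supp σ` says `ker σ ⊆ ker ρ`.
Since `Real.logb 2 0 = 0`, the functional calculus gives the logarithm taken on the support and
extended by zero to the kernel. -/
def relEntropy {n : Type*} [Fintype n] [DecidableEq n] (ρ σ : Matrix n n ℂ) : EReal :=
  if ∀ v : n → ℂ, σ.mulVec v = 0 → ρ.mulVec v = 0 then
    (((ρ * (cfc (Real.logb 2) ρ - cfc (Real.logb 2) σ)).trace.re : ℝ) : EReal)
  else ⊤

variable {A X B : Type*} [Fintype A] [Fintype X] [Fintype B]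

/-- An assemblage `{ρ^{a,x}}`: positive semidefinite operators on Bob's system which satisfy the
no-signaling principle and for which the reduced operator `∑ₐ ρ^{a,x}` is a quantum state. -/
structure IsAssemblage (ρ : A → X → Matrix B B ℂ) : Prop where
  posSemidef : ∀ a x, (ρ a x).PosSemidef
  noSignaling : ∀ x x', ∑ a, ρ a x = ∑ a, ρ a x'
  isState : ∀ x, IsState (∑ a, ρ a x)

/-- The set of assemblages having a local-hidden-state model:
`ρ^{a,x} = ∑_l p(l) q(a|x,l) τ^l` with `p` a probability distribution, `q` a conditional
probability distribution and each `τ^l` a quantum state. -/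
def LHS (A X B : Type*) [Fintype A] [Fintype X] [Fintype B] : Set (A → X → Matrix B B ℂ) :=
  {ρ | IsAssemblage ρ ∧
    ∃ (m : ℕ) (p : Fin m → ℝ) (q : A → X → Fin m → ℝ) (τ : Fin m → Matrix B B ℂ),
      p ∈ stdSimplex ℝ (Fin m) ∧
      (∀ x l, (fun a => q a x l) ∈ stdSimplex ℝ A) ∧
      (∀ l, IsState (τ l)) ∧
      ∀ a x, ρ a x = ∑ l, (p l * q a x l) • τ l}

variable [DecidableEq A] [DecidableEq X]

/-- The classical-classical-quantum operator
`∑_{x,a} p(x) |x⟩⟨x| ⊗ |a⟩⟨a| ⊗ ρ^{a,x}`. -/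
def cqState (p : X → ℝ) (ρ : A → X → Matrix B B ℂ) : Matrix (X × A × B) (X × A × B) ℂ :=
  ∑ x, ∑ a, p x • (Matrix.single x x (1 : ℂ) ⊗ₖ (Matrix.single a a (1 : ℂ) ⊗ₖ ρ a x))

/-- The restricted relative entropy of steering: the supremum over probability distributions `p`
on the input alphabet of the infimum over `σ ∈ LHS` of the relative entropy between the two
classical-classical-quantum states. -/
def restrictedRelEntropy [DecidableEq B] (ρ : A → X → Matrix B B ℂ) : EReal :=
  ⨆ p ∈ stdSimplex ℝ X, ⨅ σ ∈ LHS A X B, relEntropy (cqState p ρ) (cqState p σ)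

end

end Steering

/-! The core is Pinsker's inequality, proved directly in the quantum setting
(`sq_trace_le_of_isState`). With eigenvalues `r i`, `s j` of the two states and overlaps `V` of
their eigenbases, both the relative entropy and the trace of the difference against a unitary become
double sums over `(i, j)`. A scalar inequality compares them term by term, and a weighted
Cauchy–Schwarz inequality sums up. A block-diagonal unitary then attains all the trace norms of an
assemblage difference at once (`sq_sum_traceNorm_le`), and the uniform input distribution gives the
bound.

Finiteness holds because the uniform-outcome assemblage, which is unsteerable, dominates `ρ` up to
the factor `|A|`, whatever the input distribution. For faithfulness, deterministic strategies
present `LHS` as a continuous image of a compact set, so distance zero is attained. -/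

/-! ### The scalar inequality behind Pinsker -/

/-- A strengthening of the tangent-line bound `t * log t ≥ t - 1`, homogenised. -/
lemma Real.sq_sub_le_mul_klDiv {r s : ℝ} (hr : 0 ≤ r) (hs : 0 < s) :
    (r - s) ^ 2 ≤ (2 / 3 * r + 4 / 3 * s) * (r * Real.log r - r * Real.log s - r + s) := by
  rcases hr.eq_or_lt with rfl | hr
  · nlinarith [sq_nonneg s]
  -- With `t = r / s`, solving the claim for `log t` gives exactly `0 ≤ g t`. The derivative has the
  -- sign of `t - 1`, so `g` is minimal at `1`, where it vanishes.
  set g : ℝ → ℝ := fun t => Real.log t - (t - 1) * (5 * t + 1) / (2 * t * (t + 2)) with hg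
  have hd : ∀ t : ℝ, 0 < t → HasDerivAt g ((t - 1) ^ 3 / (t ^ 2 * (t + 2) ^ 2)) t := by
    intro t ht
    have h1 : HasDerivAt (fun t : ℝ => (t - 1) * (5 * t + 1)) (1 * (5 * t + 1) + (t - 1) * (5 * 1)) t :=
      ((hasDerivAt_id t).sub_const 1).mul (((hasDerivAt_id t).const_mul 5).add_const 1)
    have h2 : HasDerivAt (fun t : ℝ => 2 * t * (t + 2)) (2 * 1 * (t + 2) + 2 * t * 1) t :=
      ((hasDerivAt_id t).const_mul 2).mul ((hasDerivAt_id t).add_const 2)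
    have h3 := (Real.hasDerivAt_log ht.ne').sub (h1.div h2 (by positivity))
    refine h3.congr_deriv ?_
    field_simp
    ring
  have hg1 : g 1 = 0 := by simp [hg]
  have hpos : ∀ t : ℝ, 0 < t → 0 ≤ g t := by
    intro t ht
    rcases le_total 1 t with h | h
    · have : MonotoneOn g (Set.Ici 1) := by
        refine monotoneOn_of_deriv_nonneg (convex_Ici 1) (fun x hx => ?_) (fun x hx => ?_)
          (fun x hx => ?_)
        · exact (hd x (by have := Set.mem_Ici.1 hx; linarith)).continuousAt.continuousWithinAt
        · rw [interior_Ici] at hx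
          exact (hd x (by have := Set.mem_Ioi.1 hx; linarith)).differentiableAt.differentiableWithinAt
        · rw [interior_Ici] at hx
          have hx1 := Set.mem_Ioi.1 hx
          rw [(hd x (by linarith)).deriv]
          have : 0 ≤ x - 1 := by linarith
          positivity
      rw [← hg1]
      exact this (Set.mem_Ici.2 le_rfl) h h
    · have : AntitoneOn g (Set.Ioc 0 1) := by
        refine antitoneOn_of_deriv_nonpos (convex_Ioc 0 1) (fun x hx => ?_) (fun x hx => ?_)
          (fun x hx => ?_)
        · exact (hd x hx.1).continuousAt.continuousWithinAt
        · exact (hd x (interior_subset hx).1).differentiableAt.differentiableWithinAt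
        · have hx1 := interior_subset hx
          rw [(hd x hx1.1).deriv]
          refine div_nonpos_of_nonpos_of_nonneg ?_ (by positivity)
          exact (Odd.pow_nonpos_iff (by decide)).2 (by linarith [hx1.2])
      rw [← hg1]
      exact this ⟨ht, h⟩ ⟨one_pos, le_rfl⟩ h
  have h := hpos (r / s) (by positivity)
  simp only [hg, Real.log_div hr.ne' hs.ne'] at h
  have e : (r / s - 1) * (5 * (r / s) + 1) / (2 * (r / s) * (r / s + 2))
      = (r - s) * (5 * r + s) / (2 * r * (r + 2 * s)) := by
    field_simp
  rw [e, sub_nonneg, div_le_iff₀ (by positivity)] at h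
  linarith

/-! ### Spectral calculus and positivity of matrices -/

namespace Matrix

/-- In the Loewner order `0 ≤ P ≤ Q`, so the quadratic form of `P` at `v` is squeezed to zero. This
turns domination into the support condition of the relative entropy. -/
lemma PosSemidef.mulVec_eq_zero_of_sub {n : Type*} [Fintype n] {P Q : Matrix n n ℂ} (hP : P.PosSemidef)
    (hQP : (Q - P).PosSemidef) {v : n → ℂ} (hv : Q *ᵥ v = 0) : P *ᵥ v = 0 := by
  have h := hQP.dotProduct_mulVec_nonneg v
  rw [sub_mulVec, hv, zero_sub, dotProduct_neg, neg_nonneg] at h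
  exact (hP.dotProduct_mulVec_zero_iff v).1 (le_antisymm h (hP.dotProduct_mulVec_nonneg v))

variable {n : Type*} [Fintype n] [DecidableEq n]

/-- Diagonalisation of a Hermitian matrix, together with its functional calculus. -/
lemma IsHermitian.exists_diagonalization {M : Matrix n n ℂ} (hM : M.IsHermitian) :
    ∃ (U : Matrix n n ℂ) (d : n → ℝ), Uᴴ * U = 1 ∧ U * Uᴴ = 1 ∧ (∀ i, d i ∈ spectrum ℝ M) ∧
      (∀ i, M *ᵥ (fun k => U k i) = (d i : ℂ) • fun k => U k i) ∧
      ∀ f : ℝ → ℝ, cfc f M = U * diagonal (fun i => (f (d i) : ℂ)) * Uᴴ := by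
  refine ⟨hM.eigenvectorUnitary, hM.eigenvalues, ?_, ?_, hM.eigenvalues_mem_spectrum_real, ?_, ?_⟩
  · exact Unitary.coe_star_mul_self _
  · exact Unitary.coe_mul_star_self _
  · intro i
    have := hM.mulVec_eigenvectorBasis i
    rw [← hM.eigenvectorUnitary_col_eq i] at this
    ext k
    have := congrFun this k
    simpa using this
  · intro f
    rw [hM.cfc_eq, IsHermitian.cfc, Unitary.conjStarAlgAut_apply]
    rfl

lemma trace_diagonal_mul_mul_diagonal_mul (a b : n → ℂ) (V W : Matrix n n ℂ) :
    (diagonal a * V * diagonal b * W).trace = ∑ i, ∑ j, a i * b j * (V i j * W j i) := by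
  simp only [trace, diag, mul_apply (M := _ * diagonal b), mul_diagonal, diagonal_mul]
  exact Finset.sum_congr rfl fun i _ => Finset.sum_congr rfl fun j _ => by ring

lemma sum_normSq_row {V : Matrix n n ℂ} (hV : V * Vᴴ = 1) (i : n) :
    ∑ j, Complex.normSq (V i j) = 1 := by
  have h := congrFun (congrFun hV i) i
  rw [mul_apply, one_apply_eq] at h
  have h2 := congrArg Complex.re h
  simpa [Complex.mul_conj] using h2

lemma sum_normSq_col {V : Matrix n n ℂ} (hV : Vᴴ * V = 1) (j : n) :
    ∑ i, Complex.normSq (V i j) = 1 := by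
  have h := sum_normSq_row (V := Vᴴ) (by simpa using hV) j
  simpa using h

-- Writing `Q = Rᴴ * R`, cyclicity turns the trace into that of `R * P * Rᴴ`.
open scoped MatrixOrder in
lemma PosSemidef.trace_mul_nonneg {P Q : Matrix n n ℂ} (hP : P.PosSemidef) (hQ : Q.PosSemidef) :
    0 ≤ (P * Q).trace := by
  obtain ⟨R, rfl⟩ := CStarAlgebra.nonneg_iff_eq_star_mul_self.1 hQ.nonneg
  rw [← Matrix.mul_assoc, trace_mul_comm, ← Matrix.mul_assoc]
  exact (hP.mul_mul_conjTranspose_same R).trace_nonneg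

lemma PosSemidef.nonneg_of_mem_spectrum {P : Matrix n n ℂ} (hP : P.PosSemidef) {x : ℝ}
    (hx : x ∈ spectrum ℝ P) : 0 ≤ x := by
  rw [hP.1.spectrum_real_eq_range_eigenvalues] at hx
  obtain ⟨i, rfl⟩ := hx
  exact hP.eigenvalues_nonneg i

lemma continuousOn_spectrum {M : Matrix n n ℂ} (f : ℝ → ℝ) : ContinuousOn f (spectrum ℝ M) :=
  Matrix.finite_real_spectrum.continuousOn f

lemma PosSemidef.cfc {M : Matrix n n ℂ} (hM : M.IsHermitian) {f : ℝ → ℝ}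
    (hf : ∀ x ∈ spectrum ℝ M, 0 ≤ f x) : (cfc f M).PosSemidef := by
  obtain ⟨U, d, -, -, hd, -, hU⟩ := hM.exists_diagonalization
  rw [hU f]
  refine PosSemidef.mul_mul_conjTranspose_same (PosSemidef.diagonal fun i => ?_) U
  simpa using hf _ (hd i)

lemma IsHermitian.cfc_id_eq {M : Matrix n n ℂ} (hM : M.IsHermitian) :
    _root_.cfc (fun x : ℝ => x) M = M :=
  _root_.cfc_id' ℝ M hM.isSelfAdjoint

lemma trace_cfc_re_eq_sum {M U : Matrix n n ℂ} {d : n → ℝ} (h1 : Uᴴ * U = 1)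
    (hU : ∀ f : ℝ → ℝ, _root_.cfc f M = U * diagonal (fun i => (f (d i) : ℂ)) * Uᴴ) (f : ℝ → ℝ) :
    (_root_.cfc f M).trace.re = ∑ i, f (d i) := by
  rw [hU f, trace_mul_comm, ← Matrix.mul_assoc, h1, Matrix.one_mul, trace_diagonal]
  simp

end Matrix

/-! ### Quantum Pinsker inequality and bounds on the relative entropy -/

namespace Steering

open Matrix

variable {n : Type*} [Fintype n] [DecidableEq n]

/-- Pinsker's inequality for the quantum relative entropy, tested against a unitary. -/
lemma sq_trace_le_of_isState {ρ σ K : Matrix n n ℂ} (hρ : IsState ρ) (hσ : IsState σ)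
    (hK : Kᴴ * K = 1) (hsupp : ∀ v : n → ℂ, σ.mulVec v = 0 → ρ.mulVec v = 0) :
    (K * (ρ - σ)).trace.re ^ 2 ≤
      2 * Real.log 2 * (ρ * (cfc (Real.logb 2) ρ - cfc (Real.logb 2) σ)).trace.re := by
  obtain ⟨U, r, hU1, hU2, hr, hrv, hU⟩ := hρ.1.1.exists_diagonalization
  obtain ⟨W, s, hW1, hW2, hs, hsv, hW⟩ := hσ.1.1.exists_diagonalization
  have hr0 : ∀ i, 0 ≤ r i := fun i => hρ.1.nonneg_of_mem_spectrum (hr i)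
  have hs0 : ∀ i, 0 ≤ s i := fun i => hσ.1.nonneg_of_mem_spectrum (hs i)
  have hρU : ρ = U * diagonal (fun i => (r i : ℂ)) * Uᴴ := by
    rw [← hU fun x => x, hρ.1.1.cfc_id_eq]
  have hσW : σ = W * diagonal (fun i => (s i : ℂ)) * Wᴴ := by
    rw [← hW fun x => x, hσ.1.1.cfc_id_eq]
  have hr1 : ∑ i, r i = 1 := by
    rw [← trace_cfc_re_eq_sum hU1 hU fun x => x, hρ.1.1.cfc_id_eq, hρ.2, Complex.one_re]
  have hs1 : ∑ i, s i = 1 := by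
    rw [← trace_cfc_re_eq_sum hW1 hW fun x => x, hσ.1.1.cfc_id_eq, hσ.2, Complex.one_re]
  -- `V` holds the overlaps of the two eigenbases, and `T` is the test unitary `K` written between
  -- them. Both are unitary, so their squared entries are doubly stochastic.
  set V := Uᴴ * W with hV
  set T := Wᴴ * K * U with hT
  have hVV : V * Vᴴ = 1 := by
    simp only [hV, conjTranspose_mul, conjTranspose_conjTranspose]
    rw [Matrix.mul_assoc, ← Matrix.mul_assoc W, hW2, Matrix.one_mul, hU1]
  have hVV' : Vᴴ * V = 1 := mul_eq_one_comm.1 hVV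
  have hTT' : Tᴴ * T = 1 := by
    calc Tᴴ * T = Uᴴ * (Kᴴ * (W * Wᴴ) * K) * U := by
          simp only [hT, conjTranspose_mul, conjTranspose_conjTranspose, Matrix.mul_assoc]
      _ = 1 := by rw [hW2, Matrix.mul_one, hK, Matrix.mul_one, hU1]
  have hTT : T * Tᴴ = 1 := mul_eq_one_comm.1 hTT'
  -- The support condition in coordinates. It removes the terms with `s j = 0`, where the logarithm
  -- has a default value and the scalar inequality does not apply.
  have hzero : ∀ i j, s j = 0 → r i * Complex.normSq (V i j) = 0 := by
    intro i j hj
    have h1 : σ *ᵥ (fun k => W k j) = 0 := by rw [hsv, hj]; simp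
    have h2 : Uᴴ *ᵥ (ρ *ᵥ (fun k => W k j)) = 0 := by rw [hsupp _ h1, mulVec_zero]
    have h3 : Uᴴ * ρ = diagonal (fun i => (r i : ℂ)) * Uᴴ := by
      conv_lhs => rw [hρU]
      rw [← Matrix.mul_assoc, ← Matrix.mul_assoc, hU1, Matrix.one_mul]
    rw [mulVec_mulVec, h3, ← mulVec_mulVec] at h2
    have h4 := congrFun h2 i
    rw [mulVec_diagonal] at h4
    have h5 : (Uᴴ *ᵥ fun k => W k j) i = V i j := rfl
    rw [h5] at h4
    rcases mul_eq_zero.1 h4 with h | h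
    · rw [Complex.ofReal_eq_zero.1 h, zero_mul]
    · rw [h]; simp
  set N : n → n → ℝ := fun i j => Complex.normSq (V i j) with hN
  have hN0 : ∀ i j, 0 ≤ N i j := fun i j => Complex.normSq_nonneg _
  have hrow : ∀ i, ∑ j, N i j = 1 := sum_normSq_row hVV
  have hcol : ∀ j, ∑ i, N i j = 1 := sum_normSq_col hVV'
  -- the left-hand side in terms of matrix elements
  have hl : (K * (ρ - σ)).trace = ∑ i, ∑ j, ((r i : ℂ) - s j) * (V i j * T j i) := by
    have e1 : (K * ρ).trace =
        (diagonal (fun i => (r i : ℂ)) * V * diagonal (fun _ => (1 : ℂ)) * T).trace := by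
      rw [diagonal_one, Matrix.mul_one, hρU]
      calc (K * (U * diagonal (fun i => (r i : ℂ)) * Uᴴ)).trace
          = ((K * U) * (diagonal (fun i => (r i : ℂ)) * Uᴴ)).trace := by
            simp only [Matrix.mul_assoc]
        _ = (diagonal (fun i => (r i : ℂ)) * Uᴴ * (K * U)).trace := trace_mul_comm _ _
        _ = (diagonal (fun i => (r i : ℂ)) * Uᴴ * ((W * Wᴴ) * K * U)).trace := by
            rw [hW2, Matrix.one_mul]
        _ = _ := by simp only [hV, hT, Matrix.mul_assoc]
    have e2 : (K * σ).trace =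
        (diagonal (fun _ => (1 : ℂ)) * V * diagonal (fun i => (s i : ℂ)) * T).trace := by
      rw [diagonal_one, Matrix.one_mul, hσW]
      calc (K * (W * diagonal (fun i => (s i : ℂ)) * Wᴴ)).trace
          = ((U * Uᴴ) * (W * diagonal (fun i => (s i : ℂ)) * Wᴴ * K)).trace := by
            rw [hU2, Matrix.one_mul, trace_mul_comm]
        _ = (U * (Uᴴ * (W * diagonal (fun i => (s i : ℂ)) * Wᴴ * K))).trace := by
            simp only [Matrix.mul_assoc]
        _ = ((Uᴴ * (W * diagonal (fun i => (s i : ℂ)) * Wᴴ * K)) * U).trace := trace_mul_comm _ _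
        _ = _ := by simp only [hV, hT, Matrix.mul_assoc]
    rw [Matrix.mul_sub, trace_sub, e1, e2, trace_diagonal_mul_mul_diagonal_mul,
      trace_diagonal_mul_mul_diagonal_mul, ← Finset.sum_sub_distrib]
    refine Finset.sum_congr rfl fun i _ => ?_
    rw [← Finset.sum_sub_distrib]
    exact Finset.sum_congr rfl fun j _ => by ring
  -- the relative entropy in terms of the same matrix elements
  have hcross : (ρ * cfc (Real.logb 2) σ).trace.re =
      ∑ i, ∑ j, r i * Real.logb 2 (s j) * N i j := by
    have e : (ρ * cfc (Real.logb 2) σ).trace = (diagonal (fun i => (r i : ℂ)) * V *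
        diagonal (fun j => (Real.logb 2 (s j) : ℂ)) * Vᴴ).trace := by
      rw [hW, hρU]
      calc _ = (U * (diagonal (fun i => (r i : ℂ)) * Uᴴ *
            (W * diagonal (fun j => (Real.logb 2 (s j) : ℂ)) * Wᴴ))).trace := by
            simp only [Matrix.mul_assoc]
        _ = (diagonal (fun i => (r i : ℂ)) * Uᴴ *
            (W * diagonal (fun j => (Real.logb 2 (s j) : ℂ)) * Wᴴ) * U).trace := trace_mul_comm _ _
        _ = _ := by simp only [hV, conjTranspose_mul, conjTranspose_conjTranspose, Matrix.mul_assoc]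
    rw [e, trace_diagonal_mul_mul_diagonal_mul, Complex.re_sum]
    refine Finset.sum_congr rfl fun i _ => ?_
    rw [Complex.re_sum]
    refine Finset.sum_congr rfl fun j _ => ?_
    rw [conjTranspose_apply, Complex.star_def, Complex.mul_conj, ← Complex.ofReal_mul,
      ← Complex.ofReal_mul, Complex.ofReal_re]
  have hself : (ρ * cfc (Real.logb 2) ρ).trace.re = ∑ i, r i * Real.logb 2 (r i) := by
    have e : ρ * cfc (Real.logb 2) ρ = cfc (fun x => x * Real.logb 2 x) ρ := by
      rw [cfc_mul (fun x => x) (Real.logb 2) ρ (continuousOn_spectrum _) (continuousOn_spectrum _),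
        hρ.1.1.cfc_id_eq]
    rw [e, trace_cfc_re_eq_sum hU1 hU]
  have hlog2 : Real.log 2 ≠ 0 := (Real.log_pos one_lt_two).ne'
  -- The correction `- r i + s j` sums to zero against `N`, since both traces are 1, and it makes
  -- every single term nonnegative.
  set g : n → n → ℝ := fun i j =>
    N i j * (r i * Real.log (r i) - r i * Real.log (s j) - r i + s j) with hg
  have hD : Real.log 2 * (ρ * (cfc (Real.logb 2) ρ - cfc (Real.logb 2) σ)).trace.re =
      ∑ i, ∑ j, g i j := by
    rw [Matrix.mul_sub, trace_sub, Complex.sub_re, hcross, hself, mul_sub, Finset.mul_sum,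
      Finset.mul_sum]
    have e1 : ∀ i, Real.log 2 * (r i * Real.logb 2 (r i)) = ∑ j, N i j * (r i * Real.log (r i)) := by
      intro i
      rw [← Finset.sum_mul, hrow, one_mul, Real.logb]
      field_simp
    have e2 : ∀ i, Real.log 2 * ∑ j, r i * Real.logb 2 (s j) * N i j =
        ∑ j, N i j * (r i * Real.log (s j)) := by
      intro i
      rw [Finset.mul_sum]
      refine Finset.sum_congr rfl fun j _ => ?_
      rw [Real.logb]
      field_simp
    have e3 : ∑ i, ∑ j, N i j * r i = 1 := by
      simp_rw [← Finset.sum_mul, hrow, one_mul, hr1]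
    have e4 : ∑ i, ∑ j, N i j * s j = 1 := by
      rw [Finset.sum_comm]
      simp_rw [← Finset.sum_mul, hcol, one_mul, hs1]
    simp only [hg, mul_add, mul_sub, Finset.sum_add_distrib, Finset.sum_sub_distrib, e3, e4]
    simp only [e1, e2]
    ring
  -- Cauchy–Schwarz: the scalar inequality splits each squared summand into a weight carrying `T`
  -- times an entropy term carrying `V`.
  have hCS : (∑ p : n × n, |r p.1 - s p.2| * (‖V p.1 p.2‖ * ‖T p.2 p.1‖)) ^ 2 ≤
      (∑ p : n × n, (2 / 3 * r p.1 + 4 / 3 * s p.2) * Complex.normSq (T p.2 p.1)) *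
      ∑ p : n × n, g p.1 p.2 := by
    have key : ∀ i j, (r i - s j) ^ 2 * N i j ≤ (2 / 3 * r i + 4 / 3 * s j) * g i j := by
      intro i j
      rcases (hs0 j).eq_or_lt with h | h
      · have hz := hzero i j h.symm
        change r i * N i j = 0 at hz
        rcases mul_eq_zero.1 hz with h' | h' <;> simp [hg, h', ← h]
      · have := mul_le_mul_of_nonneg_left (Real.sq_sub_le_mul_klDiv (hr0 i) h) (hN0 i j)
        simp only [hg]
        linarith
    have gnn : ∀ i j, 0 ≤ g i j := by
      intro i j
      rcases (hs0 j).eq_or_lt with h | h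
      · have hz := hzero i j h.symm
        change r i * N i j = 0 at hz
        rcases mul_eq_zero.1 hz with h' | h' <;> simp [hg, h', ← h]
      · have h1 := key i j
        have h2 : 0 < 2 / 3 * r i + 4 / 3 * s j := by linarith [hr0 i]
        exact nonneg_of_mul_nonneg_right
          ((mul_nonneg (sq_nonneg _) (hN0 i j)).trans h1) h2
    refine Finset.sum_sq_le_sum_mul_sum_of_sq_le_mul _ (fun p _ => ?_) (fun p _ => gnn _ _)
      (fun p _ => ?_)
    · have := hr0 p.1
      have := hs0 p.2
      have := Complex.normSq_nonneg (T p.2 p.1)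
      positivity
    · rw [mul_pow, mul_pow, sq_abs, ← Complex.normSq_eq_norm_sq, ← Complex.normSq_eq_norm_sq]
      have := mul_le_mul_of_nonneg_right (key p.1 p.2) (Complex.normSq_nonneg (T p.2 p.1))
      simp only [hN] at this
      linarith
  -- The total weight `2 / 3 + 4 / 3` is the constant 2 in Pinsker's inequality.
  have hw : ∑ p : n × n, (2 / 3 * r p.1 + 4 / 3 * s p.2) * Complex.normSq (T p.2 p.1) = 2 := by
    rw [Fintype.sum_prod_type]
    simp only [add_mul, Finset.sum_add_distrib]
    have e1 : ∑ i, ∑ j, 2 / 3 * r i * Complex.normSq (T j i) = 2 / 3 := by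
      simp_rw [← Finset.mul_sum, sum_normSq_col hTT', mul_one, ← Finset.mul_sum, hr1, mul_one]
    have e2 : ∑ i, ∑ j, 4 / 3 * s j * Complex.normSq (T j i) = 4 / 3 := by
      rw [Finset.sum_comm]
      simp_rw [← Finset.mul_sum, sum_normSq_row hTT, mul_one, ← Finset.mul_sum, hs1, mul_one]
    rw [e1, e2]; norm_num
  have habs : |(K * (ρ - σ)).trace.re| ≤
      ∑ p : n × n, |r p.1 - s p.2| * (‖V p.1 p.2‖ * ‖T p.2 p.1‖) := by
    refine (Complex.abs_re_le_norm _).trans ?_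
    rw [hl, ← Fintype.sum_prod_type' (f := fun i j => ((r i : ℂ) - s j) * (V i j * T j i))]
    refine (norm_sum_le _ _).trans (Finset.sum_le_sum fun p _ => le_of_eq ?_)
    rw [norm_mul, norm_mul, ← Complex.ofReal_sub, Complex.norm_real, Real.norm_eq_abs]
  calc (K * (ρ - σ)).trace.re ^ 2 = |(K * (ρ - σ)).trace.re| ^ 2 := (sq_abs _).symm
    _ ≤ _ := pow_le_pow_left₀ (abs_nonneg _) habs 2
    _ ≤ _ := hCS
    _ = _ := by rw [hw, mul_assoc, hD, Fintype.sum_prod_type]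

lemma relEntropy_nonneg {ρ σ : Matrix n n ℂ} (hρ : IsState ρ) (hσ : IsState σ) :
    0 ≤ relEntropy ρ σ := by
  unfold relEntropy
  split_ifs with h
  · have := sq_trace_le_of_isState hρ hσ (K := 1) (by simp) h
    rw [EReal.coe_nonneg]
    refine nonneg_of_mul_nonneg_right ((sq_nonneg _).trans this) ?_
    have := Real.log_pos one_lt_two
    positivity
  · exact le_top

lemma IsState.spectrum_le_one {ρ : Matrix n n ℂ} (hρ : IsState ρ) {x : ℝ}
    (hx : x ∈ spectrum ℝ ρ) : x ≤ 1 := by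
  rw [hρ.1.1.spectrum_real_eq_range_eigenvalues] at hx
  obtain ⟨i, rfl⟩ := hx
  have h : ∑ i, hρ.1.1.eigenvalues i = 1 := by
    have := hρ.1.1.trace_eq_sum_eigenvalues
    have := congrArg Complex.re (this.symm.trans hρ.2)
    simpa using this
  rw [← h]
  exact Finset.single_le_sum (fun j _ => hρ.1.eigenvalues_nonneg j) (Finset.mem_univ i)

/-- Domination `ρ ≤ c σ` bounds the relative entropy independently of `ρ` and `σ`. -/
lemma relEntropy_le_of_le_smul {ρ σ : Matrix n n ℂ} (hρ : IsState ρ) (hσ : IsState σ) {c : ℝ}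
    (hc : 0 ≤ c) (h : (c • σ - ρ).PosSemidef) :
    relEntropy ρ σ ≤ ((c * (Fintype.card n / Real.log 2) : ℝ) : EReal) := by
  have hl2 := Real.log_pos one_lt_two
  have hsupp : ∀ v : n → ℂ, σ.mulVec v = 0 → ρ.mulVec v = 0 := fun v hv =>
    hρ.1.mulVec_eq_zero_of_sub h (by rw [smul_mulVec, hv, smul_zero])
  rw [relEntropy, if_pos hsupp, EReal.coe_le_coe_iff, Matrix.mul_sub, trace_sub, Complex.sub_re]
  -- Eigenvalues of a state lie in `[0, 1]`, so its logarithm is nonpositive.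
  have h1 : (ρ * cfc (Real.logb 2) ρ).trace.re ≤ 0 := by
    have hp : (cfc (fun x => -Real.logb 2 x) ρ).PosSemidef :=
      PosSemidef.cfc hρ.1.1 fun x hx => neg_nonneg.2 (Real.logb_nonpos one_lt_two
        (hρ.1.nonneg_of_mem_spectrum hx) (hρ.spectrum_le_one hx))
    have := (Complex.nonneg_iff.1 (hρ.1.trace_mul_nonneg hp)).1
    rw [cfc_neg, Matrix.mul_neg, trace_neg, Complex.neg_re] at this
    linarith
  have hp : (cfc (fun x => -Real.logb 2 x) σ).PosSemidef :=
    PosSemidef.cfc hσ.1.1 fun x hx => neg_nonneg.2 (Real.logb_nonpos one_lt_two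
      (hσ.1.nonneg_of_mem_spectrum hx) (hσ.spectrum_le_one hx))
  -- The domination `ρ ≤ c σ` is paired with the positive operator `-log₂ σ`; what remains is `c`
  -- times the entropy of `σ`.
  have h2 : -(ρ * cfc (Real.logb 2) σ).trace.re ≤
      c * (σ * cfc (fun x => -Real.logb 2 x) σ).trace.re := by
    have := (Complex.nonneg_iff.1 (h.trace_mul_nonneg hp)).1
    rw [Matrix.sub_mul, trace_sub, Complex.sub_re, smul_mul_assoc, trace_smul, Complex.smul_re,
      smul_eq_mul] at this
    rw [cfc_neg, Matrix.mul_neg ρ, trace_neg, Complex.neg_re] at this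
    rw [cfc_neg]
    linarith
  have h3 : (σ * cfc (fun x => -Real.logb 2 x) σ).trace.re ≤ Fintype.card n / Real.log 2 := by
    obtain ⟨W, s, hW1, hW2, hs, -, hW⟩ := hσ.1.1.exists_diagonalization
    have e : σ * cfc (fun x => -Real.logb 2 x) σ = cfc (fun x => x * -Real.logb 2 x) σ := by
      rw [cfc_mul (fun x => x) (fun x => -Real.logb 2 x) σ (continuousOn_spectrum _)
        (continuousOn_spectrum _), hσ.1.1.cfc_id_eq]
    rw [e, trace_cfc_re_eq_sum hW1 hW]
    -- From `log s ≥ 1 - 1 / s` one gets `-s log s ≤ 1 - s ≤ 1`, a crude bound that suffices for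
    -- finiteness.
    have : ∀ i ∈ Finset.univ, s i * -Real.logb 2 (s i) ≤ 1 / Real.log 2 := by
      intro i _
      rw [le_div_iff₀ hl2, Real.logb]
      have e : s i * -(Real.log (s i) / Real.log 2) * Real.log 2 = -(s i * Real.log (s i)) := by
        field_simp
      rw [e]
      rcases (hσ.1.nonneg_of_mem_spectrum (hs i)).eq_or_lt with h0 | h0
      · rw [← h0]; simp
      · have := Real.one_sub_inv_le_log_of_pos h0
        have h4 := mul_le_mul_of_nonneg_left this h0.le
        rw [mul_sub, mul_inv_cancel₀ h0.ne'] at h4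
        linarith
    refine (Finset.sum_le_card_nsmul _ _ _ this).trans (le_of_eq ?_)
    rw [nsmul_eq_mul, Finset.card_univ, mul_one_div]
  have := mul_le_mul_of_nonneg_left h3 hc
  linarith

end Steering

/-! ### Trace norm of Hermitian matrices -/

namespace Steering

open Matrix

section TraceNorm

variable {n : Type*} [Fintype n] [DecidableEq n]

lemma traceNorm_of_isHermitian {M : Matrix n n ℂ} (hM : M.IsHermitian) :
    traceNorm M = (cfc (fun x : ℝ => |x|) M).trace.re := by
  have h2 : Mᴴ * M = cfc (fun x : ℝ => x ^ 2) M := by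
    rw [cfc_pow (fun x : ℝ => x) 2 M (continuousOn_spectrum _) hM.isSelfAdjoint, hM.cfc_id_eq, hM.eq,
      sq]
  rw [traceNorm, h2, ← cfc_comp Real.sqrt (fun x : ℝ => x ^ 2) M hM.isSelfAdjoint
    Real.continuous_sqrt.continuousOn (continuousOn_spectrum _)]
  congr 3
  ext x
  exact Real.sqrt_sq_eq_abs x

lemma traceNorm_nonneg (M : Matrix n n ℂ) : 0 ≤ traceNorm M :=
  (Complex.nonneg_iff.1 (PosSemidef.cfc (posSemidef_conjTranspose_mul_self M).1
    fun x _ => Real.sqrt_nonneg x).trace_nonneg).1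

lemma traceNorm_of_posSemidef {M : Matrix n n ℂ} (hM : M.PosSemidef) :
    traceNorm M = M.trace.re := by
  rw [traceNorm_of_isHermitian hM.1, cfc_congr (g := fun x : ℝ => x)
    (fun x hx => abs_of_nonneg (hM.nonneg_of_mem_spectrum hx)), hM.1.cfc_id_eq]

/-- The trace norm of a Hermitian operator is attained by a unitary. -/
lemma exists_traceNorm_eq_trace_mul {M : Matrix n n ℂ} (hM : M.IsHermitian) :
    ∃ K : Matrix n n ℂ, Kᴴ * K = 1 ∧ (K * M).trace.re = traceNorm M := by
  -- The sign function with value 1 at 0, so that the result is unitary also on the kernel.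
  set f : ℝ → ℝ := fun x => if 0 ≤ x then 1 else -1 with hf
  refine ⟨cfc f M, ?_, ?_⟩
  · obtain ⟨U, d, hU1, hU2, -, -, hU⟩ := hM.exists_diagonalization
    have h : (cfc f M)ᴴ = cfc f M := (cfc_predicate f M : IsSelfAdjoint _)
    rw [h, ← cfc_mul f f M (continuousOn_spectrum _) (continuousOn_spectrum _), hU]
    have e : (fun i => ((f (d i) * f (d i) : ℝ) : ℂ)) = fun _ => 1 := by
      ext i
      simp only [hf]
      split_ifs <;> simp
    rw [e, diagonal_one, Matrix.mul_one, hU2]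
  · rw [traceNorm_of_isHermitian hM]
    have e : cfc f M * M = cfc (fun x => f x * x) M := by
      rw [cfc_mul f (fun x => x) M (continuousOn_spectrum _) (continuousOn_spectrum _),
        hM.cfc_id_eq]
    rw [e]
    congr 3
    ext x
    simp only [hf]
    split_ifs with h
    · rw [one_mul, abs_of_nonneg h]
    · rw [neg_one_mul, abs_of_neg (not_le.1 h)]

/-- Expand in the eigenbasis and bound the entries of the unitary by 1. This links the trace norm to
entrywise estimates, where compactness is easy. -/
lemma norm_apply_le_traceNorm {M : Matrix n n ℂ} (hM : M.IsHermitian) (i j : n) :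
    ‖M i j‖ ≤ traceNorm M := by
  obtain ⟨U, d, hU1, hU2, -, -, hU⟩ := hM.exists_diagonalization
  have hmem : U ∈ Matrix.unitaryGroup n ℂ := ⟨hU1, hU2⟩
  rw [traceNorm_of_isHermitian hM, trace_cfc_re_eq_sum hU1 hU]
  have e : M i j = ∑ k, U i k * d k * star (U j k) := by
    conv_lhs => rw [← hM.cfc_id_eq, hU, mul_apply]
    simp only [mul_diagonal, conjTranspose_apply]
  rw [e]
  refine (norm_sum_le _ _).trans (Finset.sum_le_sum fun k _ => ?_)
  rw [norm_mul, norm_mul, norm_star, Complex.norm_real, Real.norm_eq_abs]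
  have h1 := entry_norm_bound_of_unitary hmem i k
  have h2 := entry_norm_bound_of_unitary hmem j k
  calc ‖U i k‖ * |d k| * ‖U j k‖ ≤ 1 * |d k| * 1 := by gcongr
    _ = |d k| := by ring

end TraceNorm

/-! ### Block-diagonal operators and Pinsker for assemblages -/

section CQ

variable {A X B : Type*} [Fintype A] [Fintype X] [Fintype B] [DecidableEq A] [DecidableEq X]

omit [Fintype B] in
lemma cqState_apply (p : X → ℝ) (ρ : A → X → Matrix B B ℂ) (x x' : X) (a a' : A) (b b' : B) :
    cqState p ρ (x, a, b) (x', a', b') =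
      if x = x' then if a = a' then (p x : ℂ) * ρ a x b b' else 0 else 0 := by
  simp only [cqState, Matrix.sum_apply, Matrix.smul_apply, kroneckerMap_apply, Matrix.single_apply]
  rw [Finset.sum_eq_single x (fun y _ hy => by simp [hy]) (by simp),
    Finset.sum_eq_single a (fun y _ hy => by simp [hy]) (by simp)]
  split_ifs <;> simp_all

omit [Fintype B] in
lemma cqState_sub (p : X → ℝ) (ρ σ : A → X → Matrix B B ℂ) :
    cqState p ρ - cqState p σ = cqState p (fun a x => ρ a x - σ a x) := by
  ext ⟨x, a, b⟩ ⟨x', a', b'⟩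
  simp only [Matrix.sub_apply, cqState_apply]
  split_ifs <;> simp [mul_sub]

omit [Fintype B] in
lemma smul_cqState (c : ℝ) (p : X → ℝ) (ρ : A → X → Matrix B B ℂ) :
    c • cqState p ρ = cqState p (fun a x => c • ρ a x) := by
  ext ⟨x, a, b⟩ ⟨x', a', b'⟩
  simp only [Matrix.smul_apply, cqState_apply]
  split_ifs <;> simp [mul_left_comm]

omit [Fintype B] in
lemma cqState_conjTranspose (p : X → ℝ) (ρ : A → X → Matrix B B ℂ) :
    (cqState p ρ)ᴴ = cqState p (fun a x => (ρ a x)ᴴ) := by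
  ext ⟨x, a, b⟩ ⟨x', a', b'⟩
  simp only [conjTranspose_apply, cqState_apply]
  split_ifs <;> simp_all

lemma cqState_mul (p q : X → ℝ) (ρ σ : A → X → Matrix B B ℂ) :
    cqState p ρ * cqState q σ = cqState (fun x => p x * q x) (fun a x => ρ a x * σ a x) := by
  ext ⟨x, a, b⟩ ⟨x', a', b'⟩
  simp only [mul_apply, cqState_apply, Fintype.sum_prod_type]
  rw [Finset.sum_eq_single x (fun y _ hy => by simp [hy.symm]) (by simp),
    Finset.sum_eq_single a (fun y _ hy => by simp [hy.symm]) (by simp)]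
  simp only [if_true]
  split_ifs
  · simp only [Complex.ofReal_mul, Finset.mul_sum]
    exact Finset.sum_congr rfl fun _ _ => by ring
  · simp
  · simp

omit [Fintype B] in
lemma cqState_one [DecidableEq B] :
    cqState (fun _ : X => 1) (fun (_ : A) _ => (1 : Matrix B B ℂ)) = 1 := by
  ext ⟨x, a, b⟩ ⟨x', a', b'⟩
  simp only [cqState_apply, Matrix.one_apply, Prod.mk.injEq]
  split_ifs <;> simp_all

lemma trace_cqState (p : X → ℝ) (ρ : A → X → Matrix B B ℂ) :
    (cqState p ρ).trace = ∑ x, ∑ a, (p x : ℂ) * (ρ a x).trace := by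
  simp only [trace, diag, Fintype.sum_prod_type, cqState_apply, if_true, Finset.mul_sum]

lemma posSemidef_single {n : Type*} [DecidableEq n] (i : n) :
    (Matrix.single i i (1 : ℂ)).PosSemidef := by
  rw [← diagonal_single]
  exact PosSemidef.diagonal (Pi.single_nonneg.2 zero_le_one)

lemma posSemidef_cqState {p : X → ℝ} (hp : ∀ x, 0 ≤ p x) {ρ : A → X → Matrix B B ℂ}
    (hρ : ∀ a x, (ρ a x).PosSemidef) : (cqState p ρ).PosSemidef := by
  refine posSemidef_sum _ fun x _ => posSemidef_sum _ fun a _ => ?_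
  exact ((posSemidef_single x).kronecker ((posSemidef_single a).kronecker (hρ a x))).smul (hp x)

lemma IsAssemblage.isState_cqState {ρ : A → X → Matrix B B ℂ} (hρ : IsAssemblage ρ) {p : X → ℝ}
    (hp : p ∈ stdSimplex ℝ X) : IsState (cqState p ρ) := by
  refine ⟨posSemidef_cqState hp.1 hρ.posSemidef, ?_⟩
  rw [trace_cqState]
  have h : ∀ x, ∑ a, (p x : ℂ) * (ρ a x).trace = p x := fun x => by
    rw [← Finset.mul_sum, ← trace_sum, (hρ.isState x).2, mul_one]
  simp_rw [h]
  exact_mod_cast hp.2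

/-- Pinsker's inequality for two assemblages. -/
lemma sq_sum_traceNorm_le [DecidableEq B] {ρ σ : A → X → Matrix B B ℂ} (hρ : IsAssemblage ρ)
    (hσ : IsAssemblage σ) {p : X → ℝ} (hp : p ∈ stdSimplex ℝ X) :
    (((∑ x, ∑ a, p x * traceNorm (ρ a x - σ a x)) ^ 2 / (2 * Real.log 2) : ℝ) : EReal) ≤
      relEntropy (cqState p ρ) (cqState p σ) := by
  unfold relEntropy
  split_ifs with h
  swap
  · exact le_top
  have hH : ∀ a x, (ρ a x - σ a x).IsHermitian := fun a x =>
    (hρ.posSemidef a x).1.sub (hσ.posSemidef a x).1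
  choose K hK1 hK2 using fun a x => exists_traceNorm_eq_trace_mul (hH a x)
  -- The blocks `K a x` are glued with weight 1, not `p x`, so the result is unitary; the weights `p
  -- x` come from the states.
  have hK : (cqState (fun _ => 1) K)ᴴ * cqState (fun _ => 1) K = 1 := by
    rw [cqState_conjTranspose, cqState_mul]
    simp only [hK1, mul_one]
    exact cqState_one
  have hl2 := Real.log_pos one_lt_two
  have := sq_trace_le_of_isState (hρ.isState_cqState hp) (hσ.isState_cqState hp) hK h
  rw [cqState_sub, cqState_mul, trace_cqState] at this
  rw [EReal.coe_le_coe_iff, div_le_iff₀ (by positivity), mul_comm _ (2 * Real.log 2)]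
  have e : (∑ x, ∑ a, ((1 * p x : ℝ) : ℂ) * (K a x * (ρ a x - σ a x)).trace).re =
      ∑ x, ∑ a, p x * traceNorm (ρ a x - σ a x) := by
    simp only [Complex.re_sum, one_mul, Complex.re_ofReal_mul, hK2]
  rwa [e] at this

end CQ

end Steering

/-! ### Deterministic strategies and compactness of the local-hidden-state set -/

namespace Steering

open Matrix

variable {A X B : Type*} [Fintype A] [Fintype X] [Fintype B]

/-- The conditions are closed, and each entry is bounded by the trace of its positive matrix, hence
by the total trace 1. -/
lemma isCompact_posSemidef_sum_trace_eq_one (ι B : Type*) [Fintype ι] [Fintype B] :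
    IsCompact {τ : ι → Matrix B B ℂ | (∀ l, (τ l).PosSemidef) ∧ ∑ l, (τ l).trace = 1} := by
  classical
  have hK : IsCompact {τ : ι → Matrix B B ℂ | ∀ l i j, τ l i j ∈ Metric.closedBall (0 : ℂ) 1} := by
    have e : {τ : ι → B → B → ℂ | ∀ l i j, τ l i j ∈ Metric.closedBall (0 : ℂ) 1} =
        Set.univ.pi fun _ => Set.univ.pi fun _ => Set.univ.pi fun _ => Metric.closedBall 0 1 := by
      ext τ
      simp only [Set.mem_ofPred_eq, Set.mem_univ_pi]
    have h : IsCompact {τ : ι → B → B → ℂ | ∀ l i j, τ l i j ∈ Metric.closedBall (0 : ℂ) 1} := by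
      rw [e]
      exact isCompact_univ_pi fun _ => isCompact_univ_pi fun _ => isCompact_univ_pi
        fun _ => isCompact_closedBall 0 1
    exact h
  refine hK.of_isClosed_subset ?_ ?_
  · simp only [posSemidef_iff_dotProduct_mulVec, Set.ofPred_and, Set.ofPred_forall, IsHermitian]
    refine (isClosed_iInter fun l => ?_).inter (isClosed_eq (by fun_prop) (by fun_prop))
    refine IsClosed.inter (isClosed_eq (by fun_prop) (by fun_prop)) (isClosed_iInter fun v => ?_)
    exact isClosed_le (by fun_prop) (by fun_prop)
  · rintro τ ⟨h1, h2⟩ l i j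
    rw [mem_closedBall_zero_iff]
    refine (norm_apply_le_traceNorm (h1 l).1 i j).trans ?_
    rw [traceNorm_of_posSemidef (h1 l)]
    have h3 : ∑ l, (τ l).trace.re = 1 := by
      rw [← Complex.re_sum, h2, Complex.one_re]
    rw [← h3]
    exact Finset.single_le_sum (f := fun l => (τ l).trace.re)
      (fun l _ => (Complex.nonneg_iff.1 (h1 l).trace_nonneg).1) (Finset.mem_univ l)

/-- Drawing the outcomes independently over all inputs gives a random strategy whose marginal at `x`
is `q · x`: the sum factorises and the factors at other inputs are 1. -/
lemma sum_prod_ite_eq [DecidableEq X] [DecidableEq A] {q : A → X → ℝ}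
    (hq : ∀ x, ∑ a, q a x = 1) (a : A) (x : X) :
    ∑ f : X → A, (if f x = a then ∏ y, q (f y) y else 0) = q a x := by
  have h : ∀ f : X → A, (if f x = a then ∏ y, q (f y) y else 0) =
      ∏ y, (if y = x then if f y = a then q (f y) y else 0 else q (f y) y) := by
    intro f
    split_ifs with hf
    · refine Finset.prod_congr rfl fun y _ => ?_
      split_ifs with h1 h2 <;> simp_all
    · exact (Finset.prod_eq_zero (Finset.mem_univ x) (by simp [hf])).symm
  simp_rw [h]
  rw [← Fintype.prod_sum (fun y b => if y = x then if b = a then q b y else 0 else q b y),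
    Finset.prod_eq_single x]
  · simp
  · intro y _ hy
    simp [hy, hq]
  · simp

/-- An assemblage has a local-hidden-state model iff it has one whose hidden variable is a
deterministic strategy. -/
lemma mem_LHS_iff_deterministic [DecidableEq X] [DecidableEq A] [Nonempty X]
    {σ : A → X → Matrix B B ℂ} :
    σ ∈ LHS A X B ↔ ∃ τ : (X → A) → Matrix B B ℂ,
      ((∀ f, (τ f).PosSemidef) ∧ ∑ f, (τ f).trace = 1) ∧
      ∀ a x, σ a x = ∑ f, if f x = a then τ f else 0 := by
  constructor
  · rintro ⟨-, m, p, q, τ, hp, hq, hτ, hσ⟩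
    -- Given `l`, the outcomes for different inputs are drawn independently, so `f` has probability
    -- `∏ y, q (f y) y l`.
    refine ⟨fun f => ∑ l, (p l * ∏ y, q (f y) y l) • τ l, ⟨fun f => ?_, ?_⟩, fun a x => ?_⟩
    · exact posSemidef_sum _ fun l _ => (hτ l).1.smul
        (mul_nonneg (hp.1 l) (Finset.prod_nonneg fun y _ => (hq y l).1 _))
    · simp only [trace_sum, trace_smul, (hτ _).2]
      rw [Finset.sum_comm]
      have h : ∀ l, ∑ f : X → A, (p l * ∏ y, q (f y) y l) • (1 : ℂ) = p l := by
        intro l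
        rw [← Finset.sum_smul, ← Finset.mul_sum, ← Fintype.prod_sum (fun y b => q b y l),
          Finset.prod_eq_one fun y _ => (hq y l).2]
        simp
      simp_rw [h]
      exact_mod_cast hp.2
    · rw [hσ]
      have h : ∀ f : X → A, (if f x = a then ∑ l, (p l * ∏ y, q (f y) y l) • τ l else 0) =
          ∑ l, (p l * if f x = a then ∏ y, q (f y) y l else 0) • τ l := by
        intro f
        split_ifs <;> simp
      simp_rw [h]
      rw [Finset.sum_comm]
      refine Finset.sum_congr rfl fun l _ => ?_
      rw [← Finset.sum_smul, ← Finset.mul_sum,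
        sum_prod_ite_eq (q := fun a x => q a x l) (fun y => (hq y l).2)]
  · rintro ⟨τ, ⟨hτ, htr⟩, hσ⟩
    have hsum : ∀ x, ∑ a, σ a x = ∑ f, τ f := by
      intro x
      simp_rw [hσ]
      rw [Finset.sum_comm]
      simp
    have hre : ∀ f, ((τ f).trace.re : ℂ) = (τ f).trace := fun f =>
      (Complex.eq_re_of_ofReal_le (r := 0) (by simpa using (hτ f).trace_nonneg)).symm
    have hnn : ∀ f, 0 ≤ (τ f).trace.re := fun f => (Complex.nonneg_iff.1 (hτ f).trace_nonneg).1
    have hst : IsState (∑ f, τ f) := ⟨posSemidef_sum _ fun f _ => hτ f, by rw [trace_sum, htr]⟩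
    refine ⟨⟨fun a x => ?_, fun x x' => ?_, fun x => ?_⟩, ?_⟩
    · rw [hσ]
      refine posSemidef_sum _ fun f _ => ?_
      split_ifs
      exacts [hτ f, PosSemidef.zero]
    · rw [hsum, hsum]
    · rw [hsum]
      exact hst
    · have e := (Fintype.equivFin (X → A)).symm
      refine ⟨_, fun l => (τ (e l)).trace.re, fun a x l => if e l x = a then 1 else 0,
        -- A strategy of weight zero cannot be normalised; it receives the reduced state, an
        -- arbitrary choice killed by its weight.
        fun l => if (τ (e l)).trace.re = 0 then ∑ f, τ f else ((τ (e l)).trace.re)⁻¹ • τ (e l),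
        ⟨fun l => hnn _, ?_⟩, fun x l => ⟨fun a => ?_, by simp⟩, fun l => ?_, fun a x => ?_⟩
      · rw [e.sum_comp fun f => (τ f).trace.re, ← Complex.re_sum, htr, Complex.one_re]
      · dsimp only
        split_ifs <;> norm_num
      · dsimp only
        split_ifs with h
        · exact hst
        · refine ⟨(hτ _).smul (inv_nonneg.2 (hnn _)), ?_⟩
          rw [trace_smul, Complex.real_smul, Complex.ofReal_inv, ← hre (e l), Complex.ofReal_re]
          exact inv_mul_cancel₀ (Complex.ofReal_ne_zero.2 h)
      · rw [hσ, ← e.sum_comp]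
        refine Finset.sum_congr rfl fun l _ => ?_
        by_cases h0 : (τ (e l)).trace.re = 0
        · have hz : τ (e l) = 0 := by
            rw [← (hτ (e l)).trace_eq_zero_iff, ← hre, h0, Complex.ofReal_zero]
          simp [hz]
        · simp only [if_neg h0]
          split_ifs
          · rw [mul_one, smul_smul, mul_inv_cancel₀ h0, one_smul]
          · simp

/-- The hidden variable in the definition has unbounded range; deterministic strategies fix a finite
one, leaving a continuous image of a compact set. -/
lemma isCompact_LHS [Nonempty X] : IsCompact (LHS A X B) := by
  classical
  have h := (isCompact_posSemidef_sum_trace_eq_one (X → A) B).image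
    (f := fun τ => fun (a : A) (x : X) => ∑ f, if f x = a then τ f else 0)
    (by
      refine continuous_pi fun a => continuous_pi fun x => continuous_finsetSum _ fun f _ => ?_
      split_ifs
      · exact continuous_apply f
      · exact continuous_const)
  convert h using 1
  ext σ
  rw [mem_LHS_iff_deterministic]
  constructor
  · rintro ⟨τ, h1, h2⟩
    exact ⟨τ, h1, by ext a x : 2; exact (h2 a x).symm⟩
  · rintro ⟨τ, h1, rfl⟩
    exact ⟨τ, h1, fun _ _ => rfl⟩

omit [Fintype X] in
lemma IsAssemblage.nonempty_outcome [Nonempty X] {ρ : A → X → Matrix B B ℂ}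
    (hρ : IsAssemblage ρ) : Nonempty A := by
  by_contra h
  rw [not_nonempty_iff] at h
  have := (hρ.isState (Classical.arbitrary X)).2
  simp at this

/-- Uniformly random outcomes on top of the reduced state form an unsteerable assemblage. -/
lemma IsAssemblage.uniform_mem_LHS [Nonempty X] {ρ : A → X → Matrix B B ℂ}
    (hρ : IsAssemblage ρ) (x₀ : X) :
    (fun _ _ => (Fintype.card A : ℝ)⁻¹ • ∑ a, ρ a x₀ : A → X → Matrix B B ℂ) ∈ LHS A X B := by
  have := hρ.nonempty_outcome
  have hA : (Fintype.card A : ℝ) ≠ 0 := Nat.cast_ne_zero.2 Fintype.card_ne_zero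
  have hsum : ∑ _a : A, (Fintype.card A : ℝ)⁻¹ • ∑ a, ρ a x₀ = ∑ a, ρ a x₀ := by
    rw [← Finset.sum_smul, Finset.sum_const, nsmul_eq_mul, Finset.card_univ, mul_inv_cancel₀ hA,
      one_smul]
  refine ⟨⟨fun a x => (hρ.isState x₀).1.smul (by positivity), fun _ _ => rfl, fun x => ?_⟩,
    1, fun _ => 1, fun _ _ _ => (Fintype.card A : ℝ)⁻¹, fun _ => ∑ a, ρ a x₀, ?_, ?_,
    fun _ => hρ.isState x₀, ?_⟩
  · rw [hsum]
    exact hρ.isState x₀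
  · exact ⟨fun _ => zero_le_one, by simp⟩
  · exact fun _ _ => ⟨fun _ => by positivity, by simp [hA]⟩
  · intro a x
    simp

/-! ### Finiteness, the trace-norm bound and faithfulness -/

variable [DecidableEq A] [DecidableEq X] [DecidableEq B]

/-- The uniform-outcome assemblage works for all `p` at once, as the domination with `c = |A|` holds
block by block. -/
lemma IsAssemblage.exists_relEntropy_le [Nonempty X] {ρ : A → X → Matrix B B ℂ}
    (hρ : IsAssemblage ρ) : ∃ (C : ℝ), ∃ σ ∈ LHS A X B, ∀ p ∈ stdSimplex ℝ X,
      relEntropy (cqState p ρ) (cqState p σ) ≤ (C : EReal) := by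
  obtain ⟨x₀⟩ := ‹Nonempty X›
  have : Nonempty X := ⟨x₀⟩
  have := hρ.nonempty_outcome
  have hA : (Fintype.card A : ℝ) ≠ 0 := Nat.cast_ne_zero.2 Fintype.card_ne_zero
  have hσ := hρ.uniform_mem_LHS x₀
  refine ⟨_, _, hσ, fun p hp => relEntropy_le_of_le_smul (hρ.isState_cqState hp)
    (hσ.1.isState_cqState hp) (c := Fintype.card A) (by positivity) ?_⟩
  rw [smul_cqState, cqState_sub]
  refine posSemidef_cqState hp.1 fun a x => ?_
  -- By no-signaling the reduced state may be computed at the input `x`; subtracting `ρ a x` leaves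
  -- the sum over the other outcomes.
  rw [smul_smul, mul_inv_cancel₀ hA, one_smul, hρ.noSignaling x₀ x,
    ← Finset.sum_erase_eq_sub (Finset.mem_univ a)]
  exact posSemidef_sum _ fun b _ => hρ.posSemidef b x

lemma IsAssemblage.restrictedRelEntropy_eq_coe [Nonempty X] {ρ : A → X → Matrix B B ℂ}
    (hρ : IsAssemblage ρ) : ∃ r : ℝ, 0 ≤ r ∧ restrictedRelEntropy ρ = (r : EReal) := by
  obtain ⟨C, σ, hσ, hC⟩ := hρ.exists_relEntropy_le
  have hle : restrictedRelEntropy ρ ≤ (C : EReal) :=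
    iSup₂_le fun p hp => (iInf₂_le σ hσ).trans (hC p hp)
  have hnn : 0 ≤ restrictedRelEntropy ρ := by
    classical
    have hp := single_mem_stdSimplex ℝ (Classical.arbitrary X)
    refine le_trans ?_ (le_iSup₂ (f := fun p (_ : p ∈ stdSimplex ℝ X) =>
      ⨅ σ ∈ LHS A X B, relEntropy (cqState p ρ) (cqState p σ)) _ hp)
    exact le_iInf₂ fun τ hτ =>
      relEntropy_nonneg (hρ.isState_cqState hp) (hτ.1.isState_cqState hp)
  have h := EReal.coe_toReal (x := restrictedRelEntropy ρ)
    (ne_top_of_le_ne_top (EReal.coe_ne_top C) hle) (ne_bot_of_le_ne_bot (by simp) hnn)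
  exact ⟨(restrictedRelEntropy ρ).toReal, EReal.toReal_nonneg hnn, h.symm⟩

lemma IsAssemblage.iInf_traceNorm_le_sqrt [Nonempty X] {ρ : A → X → Matrix B B ℂ}
    (hρ : IsAssemblage ρ) {r : ℝ} (hr : restrictedRelEntropy ρ = (r : EReal)) :
    (⨅ σ : LHS A X B, 1 / (Fintype.card X : ℝ) * ∑ x, ∑ a, traceNorm (ρ a x - σ.1 a x))
      ≤ Real.sqrt (2 * Real.log 2 * r) := by
  set I := ⨅ σ : LHS A X B, 1 / (Fintype.card X : ℝ) * ∑ x, ∑ a, traceNorm (ρ a x - σ.1 a x)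
  have hX : (Fintype.card X : ℝ) ≠ 0 := Nat.cast_ne_zero.2 Fintype.card_ne_zero
  have hl2 := Real.log_pos one_lt_two
  have hnn : ∀ σ : LHS A X B,
      0 ≤ 1 / (Fintype.card X : ℝ) * ∑ x, ∑ a, traceNorm (ρ a x - σ.1 a x) := fun σ =>
    mul_nonneg (by positivity)
      (Finset.sum_nonneg fun x _ => Finset.sum_nonneg fun a _ => traceNorm_nonneg _)
  -- The uniform distribution, tested in the supremum, produces the average over inputs.
  have hp : (fun _ => 1 / (Fintype.card X : ℝ)) ∈ stdSimplex ℝ X :=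
    ⟨fun _ => by positivity, by simp [hX]⟩
  have hI : ((I ^ 2 / (2 * Real.log 2) : ℝ) : EReal) ≤ (r : EReal) := by
    rw [← hr]
    refine le_trans ?_ (le_iSup₂ (f := fun p (_ : p ∈ stdSimplex ℝ X) =>
      ⨅ σ ∈ LHS A X B, relEntropy (cqState p ρ) (cqState p σ)) _ hp)
    refine le_iInf₂ fun σ hσ => le_trans ?_ (sq_sum_traceNorm_le hρ hσ.1 hp)
    rw [EReal.coe_le_coe_iff]
    simp_rw [← Finset.mul_sum]
    gcongr
    · exact Real.iInf_nonneg hnn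
    · exact ciInf_le ⟨0, by rintro _ ⟨σ, rfl⟩; exact hnn σ⟩ (⟨σ, hσ⟩ : LHS A X B)
  rw [EReal.coe_le_coe_iff, div_le_iff₀ (by positivity)] at hI
  exact Real.le_sqrt_of_sq_le (by linarith)

-- The entrywise distance to `ρ` is visibly continuous, so it has a minimiser on the compact `LHS`.
-- It is at most `|B|²` times the trace-norm distance, so its minimum is zero.
omit [DecidableEq A] [DecidableEq X] in
lemma IsAssemblage.mem_LHS_of_iInf_traceNorm_nonpos [Nonempty X] {ρ : A → X → Matrix B B ℂ}
    (hρ : IsAssemblage ρ) (h : (⨅ σ : LHS A X B,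
      1 / (Fintype.card X : ℝ) * ∑ x, ∑ a, traceNorm (ρ a x - σ.1 a x)) ≤ 0) :
    ρ ∈ LHS A X B := by
  have hne : (LHS A X B).Nonempty := ⟨_, hρ.uniform_mem_LHS (Classical.arbitrary X)⟩
  have : Nonempty (LHS A X B) := hne.to_subtype
  have hX : (0 : ℝ) < Fintype.card X := Nat.cast_pos.2 Fintype.card_pos
  obtain ⟨σ, hσ, hmin⟩ := isCompact_LHS.exists_isMinOn hne
    (f := fun σ : A → X → Matrix B B ℂ => ∑ x, ∑ a, ∑ i, ∑ j, ‖ρ a x i j - σ a x i j‖)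
    (by fun_prop)
  set F := fun σ : A → X → Matrix B B ℂ => ∑ x, ∑ a, ∑ i, ∑ j, ‖ρ a x i j - σ a x i j‖ with hF
  have hb : ∀ τ ∈ LHS A X B, F τ ≤
      (Fintype.card B : ℝ) ^ 2 * ∑ x, ∑ a, traceNorm (ρ a x - τ a x) := by
    intro τ hτ
    rw [Finset.mul_sum]
    refine Finset.sum_le_sum fun x _ => ?_
    rw [Finset.mul_sum]
    refine Finset.sum_le_sum fun a _ => ?_
    have hle : ∀ i j, ‖ρ a x i j - τ a x i j‖ ≤ traceNorm (ρ a x - τ a x) :=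
      norm_apply_le_traceNorm ((hρ.posSemidef a x).1.sub (hτ.1.posSemidef a x).1)
    calc ∑ i, ∑ j, ‖ρ a x i j - τ a x i j‖ ≤ ∑ _i : B, ∑ _j : B, traceNorm (ρ a x - τ a x) :=
          Finset.sum_le_sum fun i _ => Finset.sum_le_sum fun j _ => hle i j
      _ = _ := by
          simp only [Finset.sum_const, Finset.card_univ, nsmul_eq_mul]
          ring
  have hF0 : F σ ≤ 0 := by
    refine le_of_forall_pos_le_add fun ε hε => ?_
    -- The `+ 1` makes `c` positive without having to show that `B` is nonempty.
    set c : ℝ := (Fintype.card B : ℝ) ^ 2 * Fintype.card X + 1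
    have hc : 0 < c := by positivity
    obtain ⟨τ, hτ⟩ := exists_lt_of_ciInf_lt (h.trans_lt (div_pos hε hc))
    have h1 := (hmin τ.2).trans (hb τ.1 τ.2)
    rw [one_div, inv_mul_lt_iff₀ hX] at hτ
    have h2 : (Fintype.card B : ℝ) ^ 2 * ∑ x, ∑ a, traceNorm (ρ a x - τ.1 a x) ≤
        (Fintype.card B : ℝ) ^ 2 * (Fintype.card X * (ε / c)) := by gcongr
    have h3 : (Fintype.card B : ℝ) ^ 2 * (Fintype.card X * (ε / c)) ≤ c * (ε / c) := by
      rw [← mul_assoc]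
      gcongr
      exact le_add_of_nonneg_right zero_le_one
    rw [mul_div_cancel₀ _ hc.ne'] at h3
    simpa using h1.trans (h2.trans h3)
  have heq : ρ = σ := by
    have h0 : ∀ a x i j, 0 ≤ ‖ρ a x i j - σ a x i j‖ := fun _ _ _ _ => norm_nonneg _
    ext a x i j
    rw [← sub_eq_zero, ← norm_le_zero_iff]
    refine le_trans ?_ hF0
    refine le_trans ?_ (Finset.single_le_sum (fun x _ => Finset.sum_nonneg fun a _ =>
      Finset.sum_nonneg fun i _ => Finset.sum_nonneg fun j _ => h0 a x i j) (Finset.mem_univ x))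
    refine le_trans ?_ (Finset.single_le_sum (fun a _ =>
      Finset.sum_nonneg fun i _ => Finset.sum_nonneg fun j _ => h0 a x i j) (Finset.mem_univ a))
    refine le_trans ?_ (Finset.single_le_sum (fun i _ => Finset.sum_nonneg fun j _ => h0 a x i j)
      (Finset.mem_univ i))
    exact Finset.single_le_sum (f := fun j => ‖ρ a x i j - σ a x i j‖)
      (fun j _ => h0 a x i j) (Finset.mem_univ j)
  rw [heq]
  exact hσ

end Steering

theorem mainTheorem11 {A X B : Type*} [Fintype A] [DecidableEq A] [Fintype X] [DecidableEq X]
    [Nonempty X] [Fintype B] [DecidableEq B]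
    (ρ : A → X → Matrix B B ℂ) (hρ : Steering.IsAssemblage ρ) :
    (∃ r : ℝ, 0 ≤ r ∧ Steering.restrictedRelEntropy ρ = (r : EReal) ∧
      (⨅ σ : Steering.LHS A X B,
        1 / (Fintype.card X : ℝ) * ∑ x, ∑ a, Steering.traceNorm (ρ a x - σ.1 a x))
        ≤ Real.sqrt (2 * Real.log 2 * r)) ∧
    (Steering.restrictedRelEntropy ρ = 0 → ρ ∈ Steering.LHS A X B) := by
  obtain ⟨r, hr0, hr⟩ := hρ.restrictedRelEntropy_eq_coe
  refine ⟨⟨r, hr0, hr, hρ.iInf_traceNorm_le_sqrt hr⟩, fun h0 => ?_⟩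
  refine hρ.mem_LHS_of_iInf_traceNorm_nonpos ?_
  have := hρ.iInf_traceNorm_le_sqrt (r := 0) (by rw [h0, EReal.coe_zero])
  simpa using this
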